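/- All graphs are finite and simple. For a graph $H$ let $\pi(H)$ be the maximum number of edges of a spanning linear forest of $H$ (a linear forest is a forest all of whose components are paths, single vertices included), and let $G[H]$ be the lexicographic product: its vertex set is $V(G)\times V(H)$, and $(g,h)$, $(g',h')$ are adjacent if and only if $gg'\in E(G)$, or $g=g'$ and $hh'\in E(H)$. Let $G$ and $H$ be graphs with $|V(G)|\ge 2$ such that $G$ contains a hamiltonian path. If $|V(G)|=2k+1$, $\pi(H)\ge 2$ and $\frac{|V(H)|+1}{k+1}\le \pi(H)$, then $G[H]$ is hamiltonian connected, that is, every two distinct vertices of $G[H]$ are the ends of a hamiltonian path of $G[H]$. -/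

import Mathlib

namespace LexHam

/-- The lexicographic product `G[H]`: `(g, h)` and `(g', h')` are adjacent iff `g g'` is an edge
of `G`, or `g = g'` and `h h'` is an edge of `H`. -/
def lexProduct {V W : Type*} (G : SimpleGraph V) (H : SimpleGraph W) : SimpleGraph (V × W) where
  Adj p q := G.Adj p.1 q.1 ∨ (p.1 = q.1 ∧ H.Adj p.2 q.2)
  symm := ⟨fun _ _ h => h.imp (fun h => h.symm) (fun h => ⟨h.1.symm, h.2.symm⟩)⟩
  loopless := ⟨fun p h => h.elim (fun h => G.irrefl h) (fun h => H.irrefl h.2)⟩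

/-- `G` is traceable if it contains a hamiltonian path. -/
def Traceable {V : Type*} [DecidableEq V] (G : SimpleGraph V) : Prop :=
  ∃ (u v : V) (p : G.Walk u v), p.IsHamiltonian

/-- `G` is hamiltonian connected if every two (distinct) vertices are connected by a
hamiltonian path. -/
def HamiltonianConnected {V : Type*} [DecidableEq V] (G : SimpleGraph V) : Prop :=
  ∀ u v : V, u ≠ v → ∃ p : G.Walk u v, p.IsHamiltonian

/-- A linear forest is a forest each of whose components is a path
(a component that is a single vertex is the path with one vertex). -/
def IsLinearForest {V : Type*} (F : SimpleGraph V) : Prop :=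
  F.IsAcyclic ∧
    ∀ c : F.ConnectedComponent, ∃ n : ℕ, Nonempty (c.toSimpleGraph ≃g SimpleGraph.pathGraph n)

/-- The numbers of edges of the spanning linear forests of `H`. -/
def linearForestSizes {V : Type*} (H : SimpleGraph V) : Set ℕ :=
  {m | ∃ F : SimpleGraph V, F ≤ H ∧ IsLinearForest F ∧ F.edgeSet.ncard = m}

/-- `π(H)`: the maximum number of edges of a spanning linear forest of `H`. -/
noncomputable def maxLinearForest {V : Type*} (H : SimpleGraph V) : ℕ :=
  sSup (linearForestSizes H)

theorem isLinearForest_bot {V : Type*} : IsLinearForest (⊥ : SimpleGraph V) := by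
  refine ⟨SimpleGraph.isAcyclic_bot, fun c => ⟨1, ?_⟩⟩
  induction c using SimpleGraph.ConnectedComponent.ind with
  | _ v =>
    have hsub : ∀ x : ((⊥ : SimpleGraph V).connectedComponentMk v), x.1 = v := fun x => by
      have h := SimpleGraph.ConnectedComponent.exact x.2
      simpa using h
    refine ⟨⟨⟨fun _ => 0, fun _ => ⟨v, rfl⟩, fun x => Subtype.ext (hsub x).symm,
      fun x => Subsingleton.elim _ _⟩, ?_⟩⟩
    intro a b
    have hab : a = b := Subtype.ext ((hsub a).trans (hsub b).symm)
    subst hab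
    simp

/-- On a finite graph the maximum that defines `π(H)` is attained. -/
theorem isGreatest_maxLinearForest {V : Type*} [Finite V] (H : SimpleGraph V) :
    IsGreatest (linearForestSizes H) (maxLinearForest H) := by
  have hne : (linearForestSizes H).Nonempty := ⟨_, ⊥, bot_le, isLinearForest_bot, rfl⟩
  have hb : BddAbove (linearForestSizes H) := by
    refine ⟨H.edgeSet.ncard, ?_⟩
    rintro _ ⟨F, hF, -, rfl⟩
    exact Set.ncard_le_ncard (SimpleGraph.edgeSet_mono hF) (Set.toFinite _)
  exact ⟨Nat.sSup_mem hne hb, fun _ hm => le_csSup hb hm⟩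

end LexHam

/-! Write `m = |V(H)|` and `p = π(H)`, and number a hamiltonian path of `G` by `0, …, 2k`. A maximum
linear forest orders `V(H)` with at least `p` consecutive adjacent pairs, so `V(H)` splits into `s`
chains whenever `m - p ≤ s ≤ m`. A walk on `0, …, 2k` with admissible visit numbers lifts to a
hamiltonian path of `G[H]`: each visit runs through one chain (`exists_isHamiltonian_lexProduct`).
Each prescribed end must be first or last in its copy of `H`, which costs at most one adjacent pair
(`exists_perm_ends`).

The walk is built from its edge crossing numbers, which need only be positive and have the parity
forced by the ends (`exists_walk_list`). Odd positions are visited exactly `m` times. As the walk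
alternates in parity, with `τ` ends at even positions the even visits exceed the odd ones by `τ -
1`. So the `k + 1` even positions must save `m + 1 - τ` visits in all, while they can save `p(k + 1)
- τ`; the hypothesis says exactly that this suffices (`exists_walk_list_of_le`). -/

namespace LexHam

/-! ### Walks on a path with prescribed crossing numbers -/

/-- A visit of `N` can be followed by `r` detours to `N + 1`. -/
theorem exists_insert_detours {N : ℕ} {L : List ℕ} (r : ℕ)
    (hL : L.IsChain (fun i j => i + 1 = j ∨ j + 1 = i)) (hN : N ∈ L) :
    ∃ L' : List ℕ, L'.IsChain (fun i j => i + 1 = j ∨ j + 1 = i) ∧ L'.head? = L.head? ∧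
      L'.getLast? = L.getLast? ∧
      ∀ i, L'.count i = L.count i + (if i = N then r else 0) + (if i = N + 1 then r else 0) := by
  induction r with
  | zero => exact ⟨L, hL, rfl, rfl, by simp⟩
  | succ r ih =>
    obtain ⟨L', hc, hh, hl, hcount⟩ := ih
    have hmem : N ∈ L' := by
      have := List.count_pos_iff.2 hN
      exact List.count_pos_iff.1 (by rw [hcount]; omega)
    obtain ⟨l₁, l₂, rfl⟩ := List.append_of_mem hmem
    refine ⟨l₁ ++ N :: (N + 1) :: N :: l₂, ?_, ?_, ?_, ?_⟩
    · rw [List.isChain_split] at hc ⊢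
      refine ⟨hc.1, ?_⟩
      simp [hc.2]
    · rw [← hh]; cases l₁ <;> simp
    · rw [← hl]; simp [List.getLast?_append, List.getLast?_cons_cons]
    · intro i
      have := hcount i
      simp only [List.count_append, List.count_cons, beq_iff_eq] at this ⊢
      split_ifs at this ⊢ <;> omega

/-- A walk on the path `0, 1, …, N` from `a` to `b` that crosses the edge between `i` and `i + 1`
exactly `e i` times. -/
theorem exists_walk_list (e : ℕ → ℕ) (N a b : ℕ) (ha : a ≤ N) (hb : b ≤ N)
    (he : ∀ i < N, 1 ≤ e i)
    (hpar : ∀ i < N, (e i + (if a ≤ i then 1 else 0) + (if b ≤ i then 1 else 0)) % 2 = 0) :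
    ∃ L : List ℕ, L.IsChain (fun i j => i + 1 = j ∨ j + 1 = i) ∧ L.head? = some a ∧
      L.getLast? = some b ∧ (∀ i, N < i → L.count i = 0) ∧
      ∀ i ≤ N, 2 * L.count i = (if i = 0 then 0 else e (i - 1)) + (if i < N then e i else 0) +
        (if a = i then 1 else 0) + (if b = i then 1 else 0) := by
  induction N generalizing a b with
  | zero =>
    obtain rfl : a = 0 := by omega
    obtain rfl : b = 0 := by omega
    refine ⟨[0], by simp, rfl, rfl, ?_, ?_⟩
    · intro i hi; simp [List.count_cons]; omega
    · intro i hi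
      obtain rfl : i = 0 := by omega
      simp
  | succ N ih =>
    -- An end at `N + 1` is first moved to `N`; the missing vertex is attached afterwards.
    obtain ⟨L, hc, hh, hl, hgt, hcount⟩ := ih (min a N) (min b N) (by omega) (by omega)
      (fun i hi => he i (by omega)) (fun i hi => by
        have h1 : min a N ≤ i ↔ a ≤ i := by omega
        have h2 : min b N ≤ i ↔ b ≤ i := by omega
        simpa only [h1, h2] using hpar i (by omega))
    have hmem : N ∈ L := by
      refine List.count_pos_iff.1 ?_
      have h1 := hcount N le_rfl
      have h2 : N ≠ 0 → 1 ≤ e (N - 1) := fun h => he (N - 1) (by omega)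
      split_ifs at h1 <;> omega
    have heN := he N (by omega)
    have hpN := hpar N (by omega)
    -- A detour crosses the last edge twice, and each end at `N + 1` accounts for one further
    -- crossing.
    obtain ⟨L', hc', hh', hl', hcount'⟩ := exists_insert_detours
      ((e N - (if a = N + 1 then 1 else 0) - (if b = N + 1 then 1 else 0)) / 2) hc hmem
    rw [hh] at hh'
    rw [hl] at hl'
    refine ⟨(if a = N + 1 then [N + 1] else []) ++ L' ++ (if b = N + 1 then [N + 1] else []),
      ?_, ?_, ?_, ?_, ?_⟩
    · have h1 : ((if a = N + 1 then [N + 1] else []) ++ L').IsChain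
          (fun i j => i + 1 = j ∨ j + 1 = i) := by
        refine List.IsChain.append (by split_ifs <;> simp) hc' ?_
        split_ifs with h
        · simp [hh']; omega
        · simp
      refine List.IsChain.append h1 (by split_ifs <;> simp) ?_
      have h2 : ((if a = N + 1 then [N + 1] else []) ++ L').getLast? = some (min b N) := by
        rw [List.getLast?_append, hl', Option.some_or]
      rw [h2]
      split_ifs with h
      · simp; omega
      · simp
    · split_ifs <;> simp [List.head?_append, hh'] <;> omega
    · split_ifs <;> simp [List.getLast?_append, List.getLast?_cons, hl'] <;> omega
    · intro i hi
      have h1 := hcount' i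
      have h2 := hgt i (by omega)
      rw [List.count_append, List.count_append, h1, h2]
      split_ifs <;> simp [List.count_cons] <;> omega
    · intro i hi
      have h1 := hcount' i
      have h2 := hcount i
      have h3 := hgt i
      have h4 : List.count i (if a = N + 1 then [N + 1] else []) =
          if a = N + 1 ∧ i = N + 1 then 1 else 0 := by
        split_ifs <;> simp [List.count_cons] <;> omega
      have h5 : List.count i (if b = N + 1 then [N + 1] else []) =
          if b = N + 1 ∧ i = N + 1 then 1 else 0 := by
        split_ifs <;> simp [List.count_cons] <;> omega
      rw [List.count_append, List.count_append, h1, h4, h5]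
      clear h1 h4 h5 hcount' hcount hgt he hpar
      rcases Nat.lt_trichotomy i N with hi' | rfl | hi'
      · have h2 := h2 (by omega)
        have ea : min a N = i ↔ a = i := by omega
        have eb : min b N = i ↔ b = i := by omega
        have e1 : i ≠ N := by omega
        have e2 : i ≠ N + 1 := by omega
        simp only [ea, eb, hi', if_true] at h2
        simp only [e1, e2, and_false, if_false, show i < N + 1 by omega, if_true]
        omega
      · have h2 := h2 (by omega)
        have e2 : i ≠ i + 1 := by omega
        simp only [lt_irrefl, if_false] at h2
        simp only [e2, and_false, if_false, if_true, show i < i + 1 by omega]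
        have ea : a ≤ i ↔ a ≠ i + 1 := by omega
        have eb : b ≤ i ↔ b ≠ i + 1 := by omega
        have ea' : min a i = i ↔ a = i ∨ a = i + 1 := by omega
        have eb' : min b i = i ↔ b = i ∨ b = i + 1 := by omega
        simp only [ea, eb, ea', eb'] at h2 hpN
        generalize (if i = 0 then 0 else e (i - 1)) = z at *
        by_cases a1 : a = i + 1 <;> by_cases b1 : b = i + 1 <;>
          simp only [a1, b1, e2.symm, ne_eq, not_true, not_false_iff, if_true, if_false,
            or_true, or_false] at h2 hpN ⊢ <;> omega
      · obtain rfl : i = N + 1 := by omega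
        have h3 := h3 (by omega)
        have e1 : N + 1 ≠ N := by omega
        have ea : a ≤ N ↔ a ≠ N + 1 := by omega
        have eb : b ≤ N ↔ b ≠ N + 1 := by omega
        simp only [ea, eb] at hpN
        simp only [h3, e1, and_true, lt_irrefl, if_true, if_false, Nat.add_sub_cancel,
          Nat.succ_ne_zero]
        by_cases a1 : a = N + 1 <;> by_cases b1 : b = N + 1 <;>
          simp only [a1, b1, ne_eq, not_true, not_false_iff, if_true, if_false] at hpN ⊢ <;> omega
-- Orderings of the vertices of `H` and their adjacent pairs
open Classical in
/-- The number of pairs of consecutive entries of a list that are edges of `H`. -/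
noncomputable def adjCount {W : Type*} (H : SimpleGraph W) : List W → ℕ
  | [] => 0
  | [_] => 0
  | a :: b :: l => (if H.Adj a b then 1 else 0) + adjCount H (b :: l)

section
variable {W : Type*} (H : SimpleGraph W)

theorem adjCount_cons_le (a : W) (l : List W) : adjCount H (a :: l) ≤ adjCount H l + 1 := by
  cases l with
  | nil => simp [adjCount]
  | cons b l => rw [adjCount]; split_ifs <;> omega

theorem adjCount_cons_le_length (a : W) (l : List W) : adjCount H (a :: l) ≤ l.length := by
  induction l generalizing a with
  | nil => simp [adjCount]
  | cons b l ih => have := ih b; rw [adjCount, List.length_cons]; split_ifs <;> omega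

theorem le_adjCount_cons (a : W) (l : List W) : adjCount H l ≤ adjCount H (a :: l) := by
  cases l with
  | nil => simp [adjCount]
  | cons b l => rw [adjCount]; omega

theorem adjCount_append_le (l₁ l₂ : List W) :
    adjCount H (l₁ ++ l₂) ≤ adjCount H l₁ + adjCount H l₂ + 1 := by
  induction l₁ with
  | nil => simp; omega
  | cons a l ih =>
    cases l with
    | nil => have := adjCount_cons_le H a l₂; simp [adjCount]; omega
    | cons b l => simp only [List.cons_append, adjCount] at ih ⊢; omega

theorem le_adjCount_append (l₁ l₂ : List W) :
    adjCount H l₁ + adjCount H l₂ ≤ adjCount H (l₁ ++ l₂) := by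
  induction l₁ with
  | nil => simp [adjCount]
  | cons a l ih =>
    cases l with
    | nil => have := le_adjCount_cons H a l₂; simp [adjCount]; omega
    | cons b l => simp only [List.cons_append, adjCount] at ih ⊢; omega

theorem adjCount_concat_concat (l : List W) (a b : W) [Decidable (H.Adj a b)] :
    adjCount H (l ++ [a, b]) = adjCount H (l ++ [a]) + if H.Adj a b then 1 else 0 := by
  induction l with
  | nil => simp only [List.nil_append, adjCount]; split_ifs <;> simp
  | cons c l ih =>
    cases l with
    | nil => simp only [List.cons_append, List.nil_append, adjCount] at ih ⊢; omega
    | cons d l => simp only [List.cons_append, adjCount] at ih ⊢; omega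

theorem adjCount_reverse (l : List W) : adjCount H l.reverse = adjCount H l := by
  classical
  induction l with
  | nil => rfl
  | cons a l ih =>
    cases l with
    | nil => rfl
    | cons b l =>
      have h := adjCount_concat_concat H l.reverse b a
      simp only [List.reverse_cons, List.append_assoc, List.cons_append, List.nil_append,
        adjCount] at ih h ⊢
      rw [h, ih, H.adj_comm b a]
      split_ifs <;> omega

/-- A list can be cut into `s` nonempty chains of `H` for each admissible number `s`. -/
theorem exists_segments (l : List W) (s : ℕ) (h₁ : l.length ≤ s + adjCount H l)
    (h₂ : s ≤ l.length) :
    ∃ S : List (List W), S.length = s ∧ S.flatten = l ∧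
      ∀ t ∈ S, t ≠ [] ∧ t.IsChain H.Adj := by
  induction l generalizing s with
  | nil =>
    obtain rfl : s = 0 := by simpa using h₂
    exact ⟨[], by simp⟩
  | cons a l ih =>
    cases l with
    | nil =>
      obtain rfl : s = 1 := by simp [adjCount] at h₁ h₂; omega
      exact ⟨[[a]], by simp⟩
    | cons b l =>
      -- If `s` is the full length of `a :: b :: l`, all chains are singletons, so `a` stays alone
      -- even when it is adjacent to `b`.
      by_cases h : H.Adj a b ∧ s ≤ (b :: l).length
      · obtain ⟨S, hs, hf, hS⟩ := ih s (by
          simp only [adjCount, h.1, if_true, List.length_cons] at h₁ ⊢; omega) h.2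
        cases S with
        | nil => simp at hf
        | cons t S =>
          have ht := hS t (by simp)
          cases t with
          | nil => simp at ht
          | cons c t =>
            obtain ⟨rfl, hf'⟩ : c = b ∧ t ++ S.flatten = l := by simpa using hf
            refine ⟨(a :: c :: t) :: S, by simpa using hs, by simp [hf'], ?_⟩
            intro u hu
            rcases List.mem_cons.1 hu with rfl | hu
            · exact ⟨by simp, by simpa using ⟨h.1, ht.2⟩⟩
            · exact hS u (by simp [hu])
      · have h' : (b :: l).length + 1 ≤ s + adjCount H (b :: l) := by
          simp only [adjCount, List.length_cons] at h₁ h ⊢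
          by_cases hab : H.Adj a b
          · simp only [hab, true_and, not_le] at h; omega
          · simp only [hab, if_false] at h₁; omega
        have hpos : 1 ≤ s := by
          have := adjCount_cons_le_length H b l
          simp only [List.length_cons] at h'
          omega
        obtain ⟨S, hs, hf, hS⟩ := ih (s - 1) (by omega) (by
          simp only [List.length_cons] at h₂ ⊢; omega)
        refine ⟨[a] :: S, by simp; omega, by simp [hf], ?_⟩
        intro u hu
        rcases List.mem_cons.1 hu with rfl | hu
        · simp
        · exact hS u hu

/-- Moving `x` to the front costs at most one edge. -/
theorem exists_perm_head (l : List W) (x : W) (hx : x ∈ l) :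
    ∃ l', l'.Perm l ∧ l'.head? = some x ∧ adjCount H l ≤ adjCount H l' + 1 := by
  obtain ⟨l₁, l₂, rfl⟩ := List.append_of_mem hx
  -- A rotation breaks only the pair that ends in `x`.
  refine ⟨x :: l₂ ++ l₁, List.perm_append_comm, rfl, ?_⟩
  have h1 := adjCount_append_le H l₁ (x :: l₂)
  have h2 := le_adjCount_append H (x :: l₂) l₁
  omega

/-- Moving `x` to the front and `y` to the end costs at most two edges. -/
theorem exists_perm_head_getLast (l : List W) (x y : W) (hx : x ∈ l) (hy : y ∈ l) (hxy : x ≠ y) :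
    ∃ l', l'.Perm l ∧ l'.head? = some x ∧ l'.getLast? = some y ∧
      adjCount H l ≤ adjCount H l' + 2 := by
  obtain ⟨l', hp, hh, hc⟩ := exists_perm_head H l x hx
  obtain ⟨l₁, l₂, rfl⟩ := List.append_of_mem (hp.mem_iff.2 hy)
  -- Reversing the tail from `y` on breaks only the pair that enters `y`.
  refine ⟨l₁ ++ (y :: l₂).reverse, (List.Perm.append_left _ (List.reverse_perm _)).trans hp,
    ?_, by simp, ?_⟩
  · cases l₁ with
    | nil => simp at hh; exact absurd hh.symm hxy
    | cons => simpa using hh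
  · have h1 := adjCount_append_le H l₁ (y :: l₂)
    have h2 := le_adjCount_append H l₁ (y :: l₂).reverse
    rw [adjCount_reverse] at h2
    omega

/-- An ordering of `l` in which `x` is first (if `P`) and `y` is last (if `Q`). -/
theorem exists_perm_ends (l : List W) (x y : W) (hx : x ∈ l) (hy : y ∈ l) (P Q : Prop)
    [Decidable P] [Decidable Q] (hxy : P → Q → x ≠ y) :
    ∃ l', l'.Perm l ∧ (P → l'.head? = some x) ∧ (Q → l'.getLast? = some y) ∧
      adjCount H l ≤ adjCount H l' + (if P then 1 else 0) + (if Q then 1 else 0) := by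
  by_cases hP : P <;> by_cases hQ : Q
  · obtain ⟨l', h1, h2, h3, h4⟩ := exists_perm_head_getLast H l x y hx hy (hxy hP hQ)
    exact ⟨l', h1, fun _ => h2, fun _ => h3, by simp [hP, hQ]; omega⟩
  · obtain ⟨l', h1, h2, h3⟩ := exists_perm_head H l x hx
    exact ⟨l', h1, fun _ => h2, fun h => absurd h hQ, by simp [hP, hQ]; omega⟩
  · obtain ⟨l', h1, h2, h3⟩ := exists_perm_head H l y hy
    refine ⟨l'.reverse, (List.reverse_perm _).trans h1, fun h => absurd h hP, fun _ => ?_, ?_⟩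
    · simpa using h2
    · rw [adjCount_reverse]; simp [hP, hQ]; omega
  · exact ⟨l, .refl _, fun h => absurd h hP, fun h => absurd h hQ, by omega⟩

/-! ### Linear forests as orderings -/

/-- Edges joining consecutive entries of `l` are counted by `adjCount`. -/
theorem ncard_consecutive_le (l : List W) :
    {e | e ∈ H.edgeSet ∧ ∃ u v, e = s(u, v) ∧ [u, v] <:+: l}.Finite ∧
    {e | e ∈ H.edgeSet ∧ ∃ u v, e = s(u, v) ∧ [u, v] <:+: l}.ncard ≤ adjCount H l := by
  classical
  induction l with
  | nil => simp
  | cons a l ih =>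
    cases l with
    | nil =>
      have : {e | e ∈ H.edgeSet ∧ ∃ u v, e = s(u, v) ∧ [u, v] <:+: [a]} = ∅ := by
        ext e
        simp only [Set.mem_ofPred_eq, Set.mem_empty_iff_false, iff_false]
        rintro ⟨-, u, v, -, h⟩
        simpa using h.length_le
      rw [this]; simp
    | cons b l =>
      have key : {e | e ∈ H.edgeSet ∧ ∃ u v, e = s(u, v) ∧ [u, v] <:+: a :: b :: l} ⊆
          (if H.Adj a b then {s(a, b)} else ∅) ∪
          {e | e ∈ H.edgeSet ∧ ∃ u v, e = s(u, v) ∧ [u, v] <:+: b :: l} := by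
        rintro e ⟨he, u, v, rfl, h⟩
        rcases List.infix_cons_iff.1 h with h | h
        · obtain ⟨rfl, rfl⟩ : u = a ∧ v = b := by simpa using h
          left
          rw [if_pos (by simpa using he)]
          rfl
        · exact Or.inr ⟨he, u, v, rfl, h⟩
      have hfin : (if H.Adj a b then {s(a, b)} else (∅ : Set (Sym2 W))).Finite := by
        split_ifs <;> simp
      refine ⟨(hfin.union ih.1).subset key, (Set.ncard_le_ncard key (hfin.union ih.1)).trans
        ((Set.ncard_union_le _ _).trans ?_)⟩
      rw [adjCount]
      refine add_le_add ?_ ih.2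
      split_ifs <;> simp

theorem adjCount_mono {F H : SimpleGraph W} (h : F ≤ H) (l : List W) :
    adjCount F l ≤ adjCount H l := by
  induction l with
  | nil => simp [adjCount]
  | cons a l ih =>
    cases l with
    | nil => simp [adjCount]
    | cons b l =>
      rw [adjCount, adjCount]
      have := @h a b
      refine add_le_add ?_ ih
      split_ifs <;> first | omega | (exfalso; tauto)

/-- The vertices of a linear forest can be listed so that all edges join consecutive entries. -/
theorem IsLinearForest.exists_list [Finite W] {F : SimpleGraph W} (hF : IsLinearForest F) :
    ∃ l : List W, l.Nodup ∧ (∀ w, w ∈ l) ∧ F.edgeSet.ncard ≤ adjCount F l := by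
  classical
  have := Fintype.ofFinite F.ConnectedComponent
  choose n hn using hF.2
  let φ := fun c => (hn c).some
  let lc : F.ConnectedComponent → List W := fun c => List.ofFn fun i => ((φ c).symm i).1
  have hmem : ∀ c w, w ∈ lc c ↔ F.connectedComponentMk w = c := by
    intro c w
    simp only [lc, List.mem_ofFn]
    constructor
    · rintro ⟨i, rfl⟩
      exact ((φ c).symm i).2
    · intro h
      exact ⟨φ c ⟨w, h⟩, by simp⟩
  refine ⟨Finset.univ.toList.flatMap lc, ?_, ?_, ?_⟩
  · rw [List.nodup_flatMap]
    refine ⟨fun c _ => List.nodup_ofFn.2 (Subtype.val_injective.comp (φ c).symm.injective), ?_⟩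
    refine (Finset.nodup_toList _).imp ?_
    intro c d hcd w hc hd
    exact hcd (((hmem c w).1 hc).symm.trans ((hmem d w).1 hd))
  · intro w
    exact List.mem_flatMap.2 ⟨F.connectedComponentMk w, by simp, (hmem _ _).2 rfl⟩
  · have h := ncard_consecutive_le F (Finset.univ.toList.flatMap lc)
    refine (Set.ncard_le_ncard ?_ h.1).trans h.2
    intro e
    induction e using Sym2.ind with
    | _ u v =>
    intro he
    refine ⟨he, ?_⟩
    have huv : F.Adj u v := he
    obtain ⟨c, hu⟩ : ∃ c, F.connectedComponentMk u = c := ⟨_, rfl⟩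
    have hv : F.connectedComponentMk v = c :=
      (SimpleGraph.ConnectedComponent.connectedComponentMk_eq_of_adj huv).symm.trans hu
    have hin : lc c <:+: Finset.univ.toList.flatMap lc := by
      obtain ⟨s, t, hst⟩ := List.append_of_mem (Finset.mem_toList.2 (Finset.mem_univ c))
      rw [hst]
      exact ⟨s.flatMap lc, t.flatMap lc, by simp⟩
    have hadj : (SimpleGraph.pathGraph (n c)).Adj (φ c ⟨u, hu⟩) (φ c ⟨v, hv⟩) :=
      (φ c).map_adj_iff.2 huv
    have hstep : ∀ i j : Fin (n c), i.val + 1 = j.val →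
        [((φ c).symm i).1, ((φ c).symm j).1] <:+: lc c := by
      intro i j hij
      have h := List.isChain_iff_getElem.1 (List.isChain_isInfix (lc c)) i.val
        (by simp only [lc, List.length_ofFn]; omega)
      simpa [lc, hij] using h
    rw [SimpleGraph.pathGraph_adj] at hadj
    rcases hadj with h | h
    · exact ⟨u, v, rfl, by simpa using (hstep _ _ h).trans hin⟩
    · exact ⟨v, u, Sym2.eq_swap, by simpa using (hstep _ _ h).trans hin⟩

end
-- Lifting a walk to `G[H]`
/-- Replace the visits of a walk in `G` by chains of `H`, to obtain a walk in `G[H]`. -/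
theorem exists_chain_lexProduct {V W : Type*} [DecidableEq V] (G : SimpleGraph V)
    (H : SimpleGraph W) (L : List V) (S : V → List (List W)) (hL : L.IsChain G.Adj)
    (hcount : ∀ v, L.count v = (S v).length)
    (hS : ∀ v, ∀ t ∈ S v, t ≠ [] ∧ t.IsChain H.Adj) :
    ∃ P : List (V × W), P.IsChain (lexProduct G H).Adj ∧
      (∀ v, (P.filter (fun q => q.1 = v)).map Prod.snd = (S v).flatten) ∧
      P.head?.map Prod.fst = L.head? ∧ P.getLast?.map Prod.fst = L.getLast? := by
  induction L generalizing S with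
  | nil =>
    refine ⟨[], by simp, fun v => ?_, rfl, rfl⟩
    have : S v = [] := List.length_eq_zero_iff.1 (by simp [← hcount v])
    simp [this]
  | cons a L ih =>
    obtain ⟨t, T, hT⟩ : ∃ t T, S a = t :: T :=
      List.exists_cons_of_length_pos (by rw [← hcount a]; simp)
    obtain ⟨htne, htc⟩ := hS a t (by simp [hT])
    -- The first visit of `a` uses up the chain `t`; later visits draw on `T`.
    obtain ⟨P, hP, hf, hh, hl⟩ := ih (Function.update S a T) (List.IsChain.tail hL) (by
        intro v
        by_cases hv : v = a
        · subst hv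
          have := hcount v
          simp [hT] at this ⊢
          exact this
        · have := hcount v
          rw [List.count_cons_of_ne (Ne.symm hv)] at this
          simp [hv, this]) (by
        intro v u hu
        by_cases hv : v = a
        · subst hv
          simp at hu
          exact hS v u (by simp [hT, hu])
        · simp [hv] at hu
          exact hS v u hu)
    refine ⟨t.map (Prod.mk a) ++ P, ?_, ?_, ?_, ?_⟩
    · refine List.IsChain.append ?_ hP ?_
      · rw [List.isChain_map]
        exact htc.imp fun _ _ h => Or.inr ⟨rfl, h⟩
      · intro p hp q hq
        have hp' : p.1 = a := by
          have := List.mem_of_mem_getLast? hp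
          simp at this
          obtain ⟨w, -, rfl⟩ := this
          rfl
        rw [Option.mem_def] at hq
        rw [hq] at hh
        have := (List.isChain_cons.1 hL).1 q.1 (by rw [← hh]; simp)
        exact Or.inl (hp' ▸ this)
    · intro v
      rw [List.filter_append, List.map_append, hf v]
      by_cases hv : v = a
      · subst hv
        simp [hT, List.filter_map, Function.comp_def]
      · simp [hv, List.filter_map, Function.comp_def, Ne.symm hv]
    · cases t with
      | nil => exact absurd rfl htne
      | cons => simp
    · rw [List.getLast?_append, List.getLast?_cons]
      cases hPl : P.getLast? with
      | some q =>
        rw [hPl] at hl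
        simp [← hl]
      | none =>
        rw [hPl] at hl
        rw [← hl]
        cases ht : t.getLast? with
        | none => exact absurd (List.getLast?_eq_none_iff.1 ht) htne
        | some w => simp [ht]

/-! ### Choice of the visit numbers -/

/-- A walk on the path `0, 1, …, 2k` from `a` to `b` whose numbers of visits lie in prescribed
ranges. -/
theorem exists_walk_list_of_le (m p k a b : ℕ) (hk : 1 ≤ k) (hp : 2 ≤ p) (hpm : p < m)
    (h : m + 1 ≤ p * (k + 1)) (ha : a ≤ 2 * k) (hb : b ≤ 2 * k) :
    ∃ L : List ℕ, L.IsChain (fun i j => i + 1 = j ∨ j + 1 = i) ∧ L.head? = some a ∧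
      L.getLast? = some b ∧ (∀ i, 2 * k < i → L.count i = 0) ∧
      ∀ i ≤ 2 * k, L.count i ≤ m ∧
        m + (if a = i then 1 else 0) + (if b = i then 1 else 0) ≤ L.count i + p := by
  -- `τ j` and `σ j` count the ends at even and at odd positions below `2 * j`
  obtain ⟨τ, hτ⟩ : ∃ τ : ℕ → ℕ, ∀ j, τ j = (if a % 2 = 0 ∧ a < 2 * j then 1 else 0) +
      (if b % 2 = 0 ∧ b < 2 * j then 1 else 0) := ⟨_, fun _ => rfl⟩
  obtain ⟨σ, hσ⟩ : ∃ σ : ℕ → ℕ, ∀ j, σ j = (if a % 2 = 1 ∧ a < 2 * j then 1 else 0) +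
      (if b % 2 = 1 ∧ b < 2 * j then 1 else 0) := ⟨_, fun _ => rfl⟩
  obtain ⟨t, ht⟩ : ∃ t : ℕ → ℕ, ∀ i, t i = (if a = i then 1 else 0) + (if b = i then 1 else 0) :=
    ⟨_, fun _ => rfl⟩
  have hτ0 : τ 0 = 0 := by simp [hτ]
  have hσ0 : σ 0 = 0 := by simp [hσ]
  have hτs : ∀ j, τ (j + 1) = τ j + t (2 * j) := by
    intro j; rw [hτ, hτ, ht]; split_ifs <;> omega
  have hσs : ∀ j, σ (j + 1) = σ j + t (2 * j + 1) := by
    intro j; rw [hσ, hσ, ht]; split_ifs <;> omega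
  have htot : τ (k + 1) + σ k = 2 := by
    rw [hτ, hσ]; split_ifs <;> omega
  have hτm : ∀ i j, i ≤ j → τ i ≤ τ j := by
    intro i j hij; rw [hτ, hτ]; split_ifs <;> omega
  have hσm : ∀ i j, i ≤ j → σ i ≤ σ j := by
    intro i j hij; rw [hσ, hσ]; split_ifs <;> omega
  have hpar : ∀ j, (τ (j + 1) + σ j + (if a ≤ 2 * j then 1 else 0) +
      (if b ≤ 2 * j then 1 else 0)) % 2 = 0 := by
    intro j; rw [hτ, hσ]; split_ifs <;> omega
  have hpar' : ∀ j, (τ (j + 1) + σ (j + 1) + (if a ≤ 2 * j + 1 then 1 else 0) +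
      (if b ≤ 2 * j + 1 then 1 else 0)) % 2 = 0 := by
    intro j; rw [hτ, hσ]; split_ifs <;> omega
  clear hτ hσ
  -- `R j` edges of `H` are used in the even positions below `2 * j`
  obtain ⟨c, hc⟩ : ∃ c, c + τ (k + 1) + (σ k + 2 - t (2 * k)) / 2 = m + 1 := by
    have := hτs k
    exact ⟨m + 1 - τ (k + 1) - (σ k + 2 - t (2 * k)) / 2, by omega⟩
  -- Savings are greedy, `p` per even position less its ends, up to the cap `c`. The cap keeps all
  -- `e (2 * j)` with `j < k` positive and the visits of `2 * k` at most `m`; as `p ≥ 2`, reaching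
  -- it still leaves `2 * k` enough visits.
  obtain ⟨R, hR⟩ : ∃ R : ℕ → ℕ, ∀ j, R j = min (p * j - τ j) c := ⟨_, fun _ => rfl⟩
  have hstep : ∀ j, p * (j + 1) = p * j + p := fun j => by ring
  have hbig : ∀ j, 2 ≤ p * (j + 1) := fun j => by rw [hstep]; omega
  have hktop := hτs k
  have hkR := hstep k
  -- Chosen so that odd positions get `m` visits and `2 * j` gets `m - (R (j + 1) - R j)` for `j <
  -- k`.
  obtain ⟨e, he0, he1⟩ : ∃ e : ℕ → ℕ,
      (∀ j, e (2 * j) = 2 * m + σ j - 2 * R (j + 1) - τ (j + 1)) ∧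
      (∀ j, e (2 * j + 1) = 2 * R (j + 1) + τ (j + 1) - σ (j + 1)) := by
    refine ⟨fun i => if i % 2 = 0 then 2 * m + σ (i / 2) - 2 * R (i / 2 + 1) - τ (i / 2 + 1)
      else 2 * R (i / 2 + 1) + τ (i / 2 + 1) - σ (i / 2 + 1), fun j => ?_, fun j => ?_⟩
    · simp
    · have h1 : (2 * j + 1) / 2 = j := by omega
      have h2 : (2 * j + 1) % 2 = 1 := by omega
      simp [h1, h2]
  have pos0 : ∀ j < k, 2 * R (j + 1) + τ (j + 1) + 1 ≤ 2 * m + σ j := by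
    intro j hj
    have h1 := hR (j + 1)
    have h2 := hτm (j + 1) k (by omega)
    omega
  have pos1 : ∀ j < k, σ (j + 1) + 1 ≤ 2 * R (j + 1) + τ (j + 1) := by
    intro j hj
    have h1 := hR (j + 1)
    have h2 := hτm (j + 1) k (by omega)
    have h3 := hσm (j + 1) k (by omega)
    have h4 := hbig j
    have h5 := hstep j
    have h6 := hstep 0
    omega
  obtain ⟨L, hL, hh, hl, hgt, hcount⟩ := exists_walk_list e (2 * k) a b ha hb (by
      intro i hi
      obtain ⟨j, rfl | rfl⟩ : ∃ j, i = 2 * j ∨ i = 2 * j + 1 := ⟨i / 2, by omega⟩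
      · have := pos0 j (by omega)
        rw [he0]; omega
      · have := pos1 j (by omega)
        rw [he1]; omega) (by
      intro i hi
      obtain ⟨j, rfl | rfl⟩ : ∃ j, i = 2 * j ∨ i = 2 * j + 1 := ⟨i / 2, by omega⟩
      · have := pos0 j (by omega)
        have h2 := hpar j
        rw [he0]
        generalize (if a ≤ 2 * j then 1 else 0) = x at *
        generalize (if b ≤ 2 * j then 1 else 0) = y at *
        omega
      · have := pos1 j (by omega)
        have h2 := hpar' j
        rw [he1]
        generalize (if a ≤ 2 * j + 1 then 1 else 0) = x at *
        generalize (if b ≤ 2 * j + 1 then 1 else 0) = y at *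
        omega)
  refine ⟨L, hL, hh, hl, hgt, ?_⟩
  intro i hi
  have h1 := hcount i hi
  rw [add_assoc _ (if a = i then 1 else 0) (if b = i then 1 else 0), ← ht i] at h1 ⊢
  clear hcount hgt hpar hpar' ht
  obtain ⟨j, rfl | rfl⟩ : ∃ j, i = 2 * j ∨ i = 2 * j + 1 := ⟨i / 2, by omega⟩
  · have g1 := hτs j
    have g2 := hR j
    have g3 := hR (j + 1)
    have g4 := hstep j
    -- Hence the truncated subtraction in `R` is a true one.
    have g5 : τ j ≤ p * j ∧ τ (j + 1) ≤ p * (j + 1) := by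
      have := hτm (j + 1) (k + 1) (by omega)
      have := hbig j
      cases j with
      | zero => simp [hτ0] at *; omega
      | succ j => have := hbig j; omega
    rcases Nat.eq_zero_or_pos j with rfl | hj
    · rw [if_pos (by omega), if_pos (by omega), he0] at h1
      have := pos0 0 (by omega)
      have := hτm 1 k (by omega)
      simp only [Nat.mul_zero, Nat.zero_add, hτ0, hσ0] at *
      omega
    · obtain ⟨j, rfl⟩ : ∃ j', j = j' + 1 := ⟨j - 1, by omega⟩
      rw [if_neg (by omega), show 2 * (j + 1) - 1 = 2 * j + 1 by omega, he1] at h1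
      have q1 := pos1 j (by omega)
      rcases Nat.lt_or_ge (j + 1) k with hjk | hjk
      · rw [if_pos (by omega), he0] at h1
        have q2 := pos0 (j + 1) hjk
        have := hτm (j + 1 + 1) k (by omega)
        omega
      -- Position `2 * k` gets `R k + τ (k + 1) - 1` visits; below the cap, the lower bound is `m +
      -- 1 ≤ p * (k + 1)`.
      · obtain rfl : j + 1 = k := by omega
        rw [if_neg (by omega)] at h1
        omega
  · rw [if_neg (by omega), if_pos (by omega), show 2 * j + 1 - 1 = 2 * j by omega, he0, he1] at h1
    have q0 := pos0 j (by omega)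
    have q1 := pos1 j (by omega)
    have := hσs j
    have := hσm (j + 1) k (by omega)
    omega

/-! ### Hamiltonian paths of `G[H]` from admissible walks -/

theorem count_map_snd_filter {V W : Type*} [DecidableEq V] [DecidableEq W]
    [BEq (V × W)] [LawfulBEq (V × W)] (P : List (V × W)) (v : V) (w : W) : ((P.filter (fun q => q.1 = v)).map Prod.snd).count w = P.count (v, w) := by
  induction P with
  | nil => rfl
  | cons q P ih =>
    obtain ⟨v', w'⟩ := q
    by_cases hv : v' = v
    · subst hv
      by_cases hw : w' = w <;> simp [ih, hw]
    · simp [ih, hv]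

theorem head?_filter_of_head? {α : Type*} {P : List α} {q : α} (f : α → Bool)
    (h : P.head? = some q) (hq : f q) : (P.filter f).head? = some q := by
  cases P with
  | nil => simp at h
  | cons a P =>
    obtain rfl : a = q := by simpa using h
    simp [hq]

/-- A walk in `G` together with an ordering of the vertices of `H` for every vertex of `G` gives
a hamiltonian path of `G[H]`, if the numbers of visits are admissible. -/
theorem exists_isHamiltonian_lexProduct {V W : Type*} [DecidableEq V] [DecidableEq W]
    (G : SimpleGraph V) (H : SimpleGraph W) (x y : V × W) (L : List V) (l : V → List W)
    (hL : L.IsChain G.Adj) (hLx : L.head? = some x.1) (hLy : L.getLast? = some y.1)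
    (hl : ∀ v w, (l v).count w = 1) (hx : (l x.1).head? = some x.2)
    (hy : (l y.1).getLast? = some y.2)
    (h₁ : ∀ v, (l v).length ≤ L.count v + adjCount H (l v))
    (h₂ : ∀ v, L.count v ≤ (l v).length) :
    ∃ p : (lexProduct G H).Walk x y, p.IsHamiltonian := by
  choose S hSc hSf hS using fun v => exists_segments H (l v) (L.count v) (h₁ v) (h₂ v)
  obtain ⟨P, hP, hf, hh, hg⟩ :=
    exists_chain_lexProduct G H L S hL (fun v => (hSc v).symm) hS
  simp only [hSf] at hf
  rw [hLx] at hh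
  rw [hLy] at hg
  have hhead : P.head? = some x := by
    obtain ⟨q, hq, hqx⟩ := Option.map_eq_some_iff.1 hh
    -- The part of `P` over `x.1` is `l x.1`, so its first entry has second coordinate `x.2`.
    have h := hf x.1
    have h3 := head?_filter_of_head? (fun q => decide (q.1 = x.1)) hq (by simpa using hqx)
    rw [← h, List.head?_map, h3] at hx
    rw [hq, Option.some_inj]
    exact Prod.ext hqx (by simpa using hx)
  have hlast : P.getLast? = some y := by
    obtain ⟨q, hq, hqy⟩ := Option.map_eq_some_iff.1 hg
    have h := hf y.1
    rw [List.getLast?_eq_head?_reverse] at hq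
    have h3 := head?_filter_of_head? (fun q => decide (q.1 = y.1)) hq (by simpa using hqy)
    rw [List.filter_reverse, ← List.getLast?_eq_head?_reverse] at h3
    rw [← h, List.getLast?_map, h3] at hy
    rw [List.getLast?_eq_head?_reverse, hq, Option.some_inj]
    exact Prod.ext hqy (by simpa using hy)
  have hne : P ≠ [] := by rintro rfl; simp at hhead
  have ex : P.head hne = x := by
    rw [List.head?_eq_some_head hne] at hhead; simpa using hhead
  have ey : P.getLast hne = y := by
    rw [List.getLast?_eq_some_getLast hne] at hlast; simpa using hlast
  refine ⟨(SimpleGraph.Walk.ofSupport P hne hP).copy ex ey, ?_⟩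
  rintro ⟨v, w⟩
  rw [SimpleGraph.Walk.support_copy, SimpleGraph.Walk.support_ofSupport]
  exact (@count_map_snd_filter V W _ _ instBEqOfDecidableEq _ P v w).symm.trans (by rw [hf, hl])

end LexHam

theorem mainTheorem8 {V W : Type*} [Fintype V] [DecidableEq V] [Fintype W] [DecidableEq W]
    (G : SimpleGraph V) (H : SimpleGraph W)
    (hcard : 2 ≤ Fintype.card V) (hG : LexHam.Traceable G)
    (k : ℕ) (hk : Fintype.card V = 2 * k + 1)
    (hpi : 2 ≤ LexHam.maxLinearForest H)
    (hbound : ((Fintype.card W : ℚ) + 1) / ((k : ℚ) + 1) ≤ (LexHam.maxLinearForest H : ℚ)) :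
    LexHam.HamiltonianConnected (LexHam.lexProduct G H) := by
  intro x y hxy
  obtain ⟨u, v, q, hq⟩ := hG
  have hlen : q.length = 2 * k := by rw [hq.length_eq, hk]; rfl
  obtain ⟨F, hFH, hF, hFp⟩ := (LexHam.isGreatest_maxLinearForest H).1
  obtain ⟨l, hnd, hmem, hadj⟩ := hF.exists_list
  have hadj' := LexHam.adjCount_mono hFH l
  rw [hFp] at hadj
  set p := LexHam.maxLinearForest H
  set m := Fintype.card W with hm
  have hlm : l.length = m := by
    rw [hm, ← List.toFinset_card_of_nodup hnd, ← Finset.card_univ]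
    congr 1
    ext w
    simp [hmem]
  have hpm : p < m := by
    cases l with
    | nil => simp only [LexHam.adjCount] at hadj hadj'; omega
    | cons w l =>
      have := LexHam.adjCount_cons_le_length H w l
      simp only [List.length_cons] at hlm
      omega
  have hbd : m + 1 ≤ p * (k + 1) := by
    rw [div_le_iff₀ (by positivity)] at hbound
    exact_mod_cast hbound
  have hsurj : ∀ v, ∃ i, i ≤ 2 * k ∧ q.getVert i = v := by
    intro v
    obtain ⟨i, hi, hi'⟩ := SimpleGraph.Walk.mem_support_iff_exists_getVert.1 (hq.mem_support v)
    exact ⟨i, by omega, hi⟩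
  have hinj : ∀ i j, i ≤ 2 * k → j ≤ 2 * k → q.getVert i = q.getVert j → i = j :=
    fun i j hi hj h => hq.isPath.getVert_injOn (by simpa [hlen] using hi)
      (by simpa [hlen] using hj) h
  obtain ⟨a, ha, hax⟩ := hsurj x.1
  obtain ⟨b, hb, hby⟩ := hsurj y.1
  obtain ⟨L, hL, hLh, hLl, hgt, hcount⟩ :=
    LexHam.exists_walk_list_of_le m p k a b (by omega) hpi hpm hbd ha hb
  have hLle : ∀ i ∈ L, i ≤ 2 * k := by
    intro i hi
    by_contra h
    have := List.count_pos_iff.2 hi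
    rw [hgt i (by omega)] at this
    omega
  have hcountmap : ∀ i ≤ 2 * k, (L.map q.getVert).count (q.getVert i) = L.count i := by
    intro i hi
    rw [List.count_eq_countP, List.countP_map, List.count_eq_countP]
    refine List.countP_congr fun j hj => ?_
    simp only [Function.comp_apply, beq_iff_eq]
    exact ⟨hinj j i (hLle j hj) hi, fun h => by rw [h]⟩
  -- If both ends lie over the same vertex of `G`, then `x ≠ y` forces `x.2 ≠ y.2`.
  choose l' hperm hx hy hc using fun v : V => LexHam.exists_perm_ends H l x.2 y.2
    (hmem _) (hmem _) (v = x.1) (v = y.1) (fun h1 h2 h => hxy (Prod.ext (h1.symm.trans h2) h))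
  have hmain : ∀ v, (L.map q.getVert).count v ≤ m ∧
      m + (if v = x.1 then 1 else 0) + (if v = y.1 then 1 else 0) ≤
        (L.map q.getVert).count v + p := by
    intro v
    obtain ⟨i, hi, rfl⟩ := hsurj v
    rw [hcountmap i hi]
    have h1 : q.getVert i = x.1 ↔ a = i := by
      rw [← hax]; exact ⟨fun h => (hinj i a hi ha h).symm, fun h => by rw [h]⟩
    have h2 : q.getVert i = y.1 ↔ b = i := by
      rw [← hby]; exact ⟨fun h => (hinj i b hi hb h).symm, fun h => by rw [h]⟩
    simp only [h1, h2]
    exact hcount i hi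
  refine LexHam.exists_isHamiltonian_lexProduct G H x y (L.map q.getVert) l' ?_ ?_ ?_ ?_
    (hx _ rfl) (hy _ rfl) ?_ ?_
  · rw [List.isChain_map]
    refine List.isChain_iff_getElem.2 fun i hi => ?_
    have h1 := hLle _ (List.getElem_mem (show i < L.length by omega))
    have h2 := hLle _ (List.getElem_mem hi)
    rcases List.isChain_iff_getElem.1 hL i hi with h | h
    · rw [← h]; exact q.adj_getVert_succ (by omega)
    · rw [← h]; exact (q.adj_getVert_succ (by omega)).symm
  · simp [hLh, hax]
  · simp [hLl, hby]
  · intro v w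
    rw [(hperm v).count_eq]
    exact List.count_eq_one_of_mem hnd (hmem w)
  · intro v
    have h1 := hmain v
    have h2 := hc v
    rw [(hperm v).length_eq, hlm]
    omega
  · intro v
    rw [(hperm v).length_eq, hlm]
    exact (hmain v).1
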